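/- Let $k$ be a field of characteristic $0$ that is complete with respect to a non-archimedean absolute value. Let $A$ be a $k$-affinoid algebra with Banach algebra norm $\|\cdot\|$: there is a surjective homomorphism of $k$-algebras $k\{r_1^{-1}T_1,\dots,r_m^{-1}T_m\}\to A$ with $r_1,\dots,r_m>0$ such that $\|\cdot\|$ is equivalent to the residue norm of the Gauss norm. Let $X=\mathcal M(A)$ be the corresponding $k$-affinoid space, that is, the set of bounded multiplicative seminorms on $A$. Let $f:X\to X$ be an automorphism of $k$-affinoid spaces, given by a bounded $k$-algebra automorphism $f^*$ of $A$ with bounded inverse, so that $|a|_{f(x)}=|f^*a|_x$ for $x\in X$ and $a\in A$. Put $\Delta_f:=f^*-\mathrm{id}:A\to A$, let $\|\Delta_f^n\|$ denote the operator norm of $\Delta_f^n$, and let $\rho(\Delta_f)=\inf_{n\ge 1}\|\Delta_f^n\|^{1/n}=\lim_{n\to\infty}\|\Delta_f^n\|^{1/n}$ be the spectral radius of $\Delta_f$. Assume that $\rho(\Delta_f)<1$. Let $V\subseteq X$ be Zariski closed, i.e. $V=\{x\in X: |g|_x=0 \text{ for all } g\in I\}$ for an ideal $I$ of $A$, and let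 $x\in X(k)$ be a $k$-point, i.e. a point of the form $a\mapsto|\chi(a)|$ for a $k$-algebra homomorphism $\chi:A\to k$. Then the set $\{n\in\mathbb Z_{\ge 0}: f^n(x)\in V\}$ is a union of at most finitely many arithmetic progressions, where an arithmetic progression is a set of the form $\{an+b: n\in\mathbb Z_{\ge 0}\}$ with $a,b\in\mathbb Z_{\ge 0}$ (a single point if $a=0$). -/

import Mathlib

namespace Affinoid

section TateAlgebra

variable (k : Type*) [NormedField k] [IsUltrametricDist k]

/-- The algebra `k{r₁⁻¹T₁, …, rₙ⁻¹Tₙ}` of power series `∑ a_ν T^ν` over `k` such that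
`‖a_ν‖ r^ν → 0`. -/
def tateAlgebra {n : ℕ} (r : Fin n → ℝ) : Subalgebra k (MvPowerSeries (Fin n) k) where
  __ := MvPowerSeries.IsRestricted.subring r
  algebraMap_mem' c := MvPowerSeries.isRestricted_C r c

variable {k}

/-- The Gauss norm `max_ν ‖a_ν‖ r^ν` on `k{r₁⁻¹T₁, …, rₙ⁻¹Tₙ}`. -/
noncomputable def tateNorm {n : ℕ} (r : Fin n → ℝ) (g : tateAlgebra k r) : ℝ :=
  MvPowerSeries.gaussNorm (fun c : k => ‖c‖) r (g : MvPowerSeries (Fin n) k)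

variable (k)

/-- A Banach `k`-algebra `A` is `k`-affinoid (in the sense of Berkovich, with arbitrary positive
radii) if there is an admissible epimorphism `φ : k{r₁⁻¹T₁, …, rₙ⁻¹Tₙ} → A`, i.e. a surjective
homomorphism of `k`-algebras for which the norm of `A` is equivalent to the residue norm
`a ↦ inf {‖g‖ | φ g = a}`. -/
def IsAffinoidAlgebra (A : Type*) [NormedCommRing A] [NormedAlgebra k A] : Prop :=
  ∃ (n : ℕ) (r : Fin n → ℝ) (φ : tateAlgebra k r →ₐ[k] A),
    (∀ i, 0 < r i) ∧ Function.Surjective φ ∧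
    ∃ C : ℝ, ∀ a : A,
      sInf (tateNorm r '' {g | φ g = a}) ≤ C * ‖a‖ ∧
      ‖a‖ ≤ C * sInf (tateNorm r '' {g | φ g = a})

end TateAlgebra

/-- The Berkovich spectrum `ℳ(A)`: the set of bounded multiplicative seminorms on `A`. -/
structure Spectrum (A : Type*) [NormedCommRing A] where
  seminorm : MulRingSeminorm A
  bounded : ∃ C : ℝ, ∀ a : A, seminorm a ≤ C * ‖a‖

/-- The Zariski closed subsets of `ℳ(A)`: the zero loci of the ideals of `A`. -/
def IsZariskiClosed {A : Type*} [NormedCommRing A] (V : Set (Spectrum A)) : Prop :=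
  ∃ I : Ideal A, V = {x | ∀ g ∈ I, x.seminorm g = 0}

section Automorphism

variable (k A : Type*) [NormedField k] [NormedCommRing A] [NormedAlgebra k A]

variable {A} in
/-- The `k`-points of `ℳ(A)`: the points `a ↦ ‖χ a‖` given by a `k`-algebra homomorphism
`χ : A → k`, equivalently the points whose completed residue field is `k`. -/
def IsRationalPoint (x : Spectrum A) : Prop :=
  ∃ χ : A →ₐ[k] k, ∀ a : A, x.seminorm a = ‖χ a‖

/-- Automorphisms `f` of the `k`-affinoid space `ℳ(A)`, given by the dual automorphism `f*` of the
`k`-affinoid algebra `A`: a `k`-algebra automorphism which is bounded with bounded inverse. -/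
structure Automorphism where
  pullback : A ≃ₐ[k] A
  bounded : ∃ C : ℝ, ∀ a : A, ‖pullback a‖ ≤ C * ‖a‖
  bounded_symm : ∃ C : ℝ, ∀ a : A, ‖pullback.symm a‖ ≤ C * ‖a‖

variable {k A}

/-- The self-map of `ℳ(A)` induced by `f*`, that is `|a|_{f(x)} = |f* a|_x`. -/
def Automorphism.toFun (f : Automorphism k A) (x : Spectrum A) : Spectrum A where
  seminorm :=
    { toFun := fun a => x.seminorm (f.pullback a)
      map_zero' := by simp
      add_le' := fun a b => by simpa using map_add_le_add x.seminorm (f.pullback a) (f.pullback b)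
      neg' := fun a => by simp
      map_one' := by simp
      map_mul' := fun a b => by simp }
  bounded := by
    obtain ⟨C, hC⟩ := x.bounded
    obtain ⟨D, hD⟩ := f.bounded
    refine ⟨max C 0 * D, fun a => ?_⟩
    calc x.seminorm (f.pullback a) ≤ C * ‖f.pullback a‖ := hC _
      _ ≤ max C 0 * ‖f.pullback a‖ := by gcongr; exact le_max_left _ _
      _ ≤ max C 0 * (D * ‖a‖) := by gcongr; exact hD a
      _ = max C 0 * D * ‖a‖ := by ring

/-- The difference operator `Δ_f = f* - id`. -/
def Automorphism.difference (f : Automorphism k A) : A →ₗ[k] A :=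
  f.pullback.toLinearMap - LinearMap.id

/-- The operator norm of a bounded `k`-linear operator on `A`. (The absolute value of `k` may be
trivial.) -/
noncomputable def opNorm (T : A →ₗ[k] A) : ℝ :=
  sInf {C : ℝ | 0 ≤ C ∧ ∀ a : A, ‖T a‖ ≤ C * ‖a‖}

/-- The spectral radius `ρ(T) = inf_{n ≥ 1} ‖Tⁿ‖^{1/n} = lim ‖Tⁿ‖^{1/n}` of a bounded `k`-linear
operator on `A`. -/
noncomputable def spectralRadius (T : A →ₗ[k] A) : ℝ :=
  ⨅ n : ℕ, opNorm (T ^ (n + 1)) ^ (1 / ((n : ℝ) + 1))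

end Automorphism

end Affinoid

/-- The arithmetic progression `{a n + b | n ∈ ℕ}`; for `a = 0` it is the one-point set `{b}`. -/
def arithmeticProgression (a b : ℕ) : Set ℕ := {m | ∃ n : ℕ, m = a * n + b}

/-!
Write `χ : A → k` for the character defining the point `x`, `Δ = f* - 1`, and let `g` lie in the
ideal of `V`. Then `fⁿ(x) ∈ V` means that the numbers
`χ(f*ⁿ g) = ∑ᵢ (n choose i) χ(Δⁱ g)` vanish for all such `g`. Since `ρ(Δ) < 1`, the coefficients
`χ(Δⁱ g)` are `O(εⁱ)` for some `ε < 1` that does not depend on `g`.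

Replacing `f` by an iterate `fᴸ` replaces `Δ` by `Q(Δ)` with `Q = (1 + X)ᴸ - 1`. In residue
characteristic `p`, the Gauss norm of `Q` on the disc of radius `ε` is as small as desired when `L`
is a large power of `p`, so `L` can be chosen such that the new coefficients decay faster than the
factorials; in residue characteristic `0` the factorials have norm `1` and `L = 1` will do
(`Affinoid.exists_gaussNorm_one_add_X_pow_sub_one_lt`). A series `∑ᵢ (n choose i) cᵢ` with
`cᵢ / i! → 0` either vanishes for all `n` or has finitely many zeros: this is Strassmann's theorem
in the basis of falling factorials, proved by reduction to the residue field
(`Affinoid.finite_or_eq_univ_zeros_newton`). Hence on each residue class modulo `L`, the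
set of return times is everything as soon as every `g` gives the zero function, and finite otherwise.
-/

/-! ### Zeros of Newton series with rapidly decreasing coefficients -/

namespace Affinoid

open Polynomial Filter Topology

/-- Over a domain of characteristic zero, a combination of falling factorials whose reduction modulo
a prime has leading term of degree `N` has at most `N` zeros among the natural numbers: the product
of the `X - z` over the zeros `z` divides it, and stays monic under reduction. -/
theorem card_le_of_eval_descPochhammer_eq_zero {R κ : Type*} [CommRing R] [IsDomain R] [CharZero R]
    [Field κ] (π : R →+* κ) (b : ℕ → R) {N M : ℕ} (hNM : N ≤ M) (hN : π (b N) ≠ 0)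
    (hlt : ∀ i, N < i → π (b i) = 0) (Z : Finset ℕ)
    (hZ : ∀ z ∈ Z, ∑ i ∈ Finset.range (M + 1), b i * (z.descFactorial i : R) = 0) :
    Z.card ≤ N := by
  set H : R[X] := ∑ i ∈ Finset.range (M + 1), C (b i) * descPochhammer R i with hH
  have hmap : H.map π = ∑ i ∈ Finset.range (N + 1), C (π (b i)) * descPochhammer κ i := by
    rw [hH, Polynomial.map_sum]
    simp only [Polynomial.map_mul, map_C, descPochhammer_map]
    refine (Finset.sum_subset (Finset.range_subset_range.2 (by omega)) fun i _ hi => ?_).symm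
    rw [hlt i (by simpa using hi), C_0, zero_mul]
  have hcoeff : (H.map π).coeff N = π (b N) := by
    rw [hmap, finsetSum_coeff, Finset.sum_range_succ, Finset.sum_eq_zero, zero_add, coeff_C_mul]
    · have := (monic_descPochhammer κ N).coeff_natDegree
      rw [descPochhammer_natDegree] at this
      rw [this, mul_one]
    · intro i hi
      rw [coeff_C_mul, coeff_eq_zero_of_natDegree_lt, mul_zero]
      rw [descPochhammer_natDegree]
      exact Finset.mem_range.1 hi
  have hdeg : (H.map π).natDegree ≤ N := by
    rw [hmap]
    refine natDegree_sum_le_of_forall_le _ _ fun i hi => (natDegree_C_mul_le _ _).trans ?_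
    rw [descPochhammer_natDegree]
    exact Nat.lt_succ_iff.1 (Finset.mem_range.1 hi)
  have hπ0 : H.map π ≠ 0 := fun h => hN (by rw [← hcoeff, h, coeff_zero])
  have hH0 : H ≠ 0 := fun h => hπ0 (by rw [h, Polynomial.map_zero])
  have hdvd : ((Z.val.map (Nat.cast : ℕ → R)).map fun a => X - C a).prod ∣ H := by
    rw [Multiset.prod_X_sub_C_dvd_iff_le_roots hH0,
      Multiset.le_iff_subset (Z.nodup.map Nat.cast_injective)]
    intro a ha
    obtain ⟨z, hz, rfl⟩ := Multiset.mem_map.1 ha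
    rw [mem_roots hH0, IsRoot.def, hH, eval_finsetSum, ← hZ z hz]
    simp [descPochhammer_eval_eq_descFactorial]
  have hmonic : ((Z.val.map (Nat.cast : ℕ → R)).map fun a => X - C a).prod.Monic :=
    monic_multisetProd_X_sub_C _
  calc Z.card = (((Z.val.map (Nat.cast : ℕ → R)).map fun a => X - C a).prod.map π).natDegree := by
        rw [hmonic.natDegree_map, natDegree_multiset_prod_X_sub_C_eq_card, Multiset.card_map,
          Finset.card_val]
    _ ≤ (H.map π).natDegree := natDegree_le_of_dvd (Polynomial.map_dvd π hdvd) hπ0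
    _ ≤ N := hdeg

/-- A null sequence that is not identically zero has a last term of maximal norm. -/
theorem exists_last_max_norm {k : Type*} [NormedAddCommGroup k] {b : ℕ → k}
    (hb : Tendsto b atTop (𝓝 0)) (h0 : ∃ i, b i ≠ 0) :
    ∃ N, b N ≠ 0 ∧ (∀ i, ‖b i‖ ≤ ‖b N‖) ∧ ∀ i, N < i → ‖b i‖ < ‖b N‖ := by
  obtain ⟨j, hj⟩ := h0
  have hfin : {i | ‖b j‖ ≤ ‖b i‖}.Finite := by
    have := (tendsto_zero_iff_norm_tendsto_zero.1 hb).eventually_lt_const (norm_pos_iff.2 hj)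
    rw [← Nat.cofinite_eq_atTop, eventually_cofinite] at this
    simpa using this
  obtain ⟨N, hN, hmax⟩ := Finset.exists_max_image hfin.toFinset
    (fun i => toLex (‖b i‖, i)) ⟨j, by simp⟩
  have hjN : ‖b j‖ ≤ ‖b N‖ := by simpa using hN
  have key : ∀ i, ‖b i‖ < ‖b N‖ ∨ ‖b i‖ = ‖b N‖ ∧ i ≤ N := by
    intro i
    by_cases hi : ‖b j‖ ≤ ‖b i‖
    · simpa [Prod.Lex.le_iff] using hmax i (by simpa using hi)
    · exact Or.inl ((not_le.1 hi).trans_le hjN)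
  refine ⟨N, norm_pos_iff.1 ((norm_pos_iff.2 hj).trans_le hjN), fun i => ?_, fun i hi => ?_⟩
  · rcases key i with h | h
    exacts [h.le, h.1.le]
  · rcases key i with h | h
    exacts [h, absurd h.2 (by omega)]

/-- A form of Strassmann's theorem: if `‖cᵢ‖ / ‖i!‖ → 0`, then the function `n ↦ ∑ᵢ (n choose i) cᵢ`
on the natural numbers is zero or has finitely many zeros. -/
theorem finite_or_eq_univ_zeros_newton {k : Type*} [NormedField k] [IsUltrametricDist k]
    [CharZero k] {c : ℕ → k} (hc : Tendsto (fun i => c i / (i.factorial : k)) atTop (𝓝 0)) :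
    {n : ℕ | ∑ i ∈ Finset.range (n + 1), (n.choose i : k) * c i = 0}.Finite ∨
      {n : ℕ | ∑ i ∈ Finset.range (n + 1), (n.choose i : k) * c i = 0} = Set.univ := by
  set b : ℕ → k := fun i => c i / (i.factorial : k) with hbdef
  have hfac : ∀ i : ℕ, (i.factorial : k) ≠ 0 := fun i => Nat.cast_ne_zero.2 i.factorial_ne_zero
  by_cases h0 : ∃ i, b i ≠ 0
  swap
  · right
    push Not at h0
    have hc0 : ∀ i, c i = 0 := fun i => by simpa [hbdef, hfac i] using h0 i
    simp [hc0]
  left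
  obtain ⟨N, hN0, hle, hlt⟩ := exists_last_max_norm hc h0
  by_contra hinf
  obtain ⟨Z, hZ, hcard⟩ := Set.Infinite.exists_subset_card_eq hinf (N + 1)
  -- Normalize so that `b N = 1`: the coefficients become integral, and those after `N` reduce to 0.
  let O := (NormedField.valuation (K := k)).valuationSubring
  have hO : ∀ y : k, y ∈ O ↔ ‖y‖ ≤ 1 := fun y => by
    rw [Valuation.mem_valuationSubring_iff, NormedField.valuation_apply, ← NNReal.coe_le_coe]
    simp
  have hbO : ∀ i, b i / b N ∈ O := fun i => by
    rw [hO, norm_div]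
    exact div_le_one_of_le₀ (hle i) (norm_nonneg _)
  let β : ℕ → O := fun i => ⟨b i / b N, hbO i⟩
  have hβN : β N = 1 := Subtype.ext (div_self hN0)
  have : CharZero O := ⟨fun m n h => Nat.cast_injective (R := k) (by
    simpa using congrArg (Subtype.val : O → k) h)⟩
  -- All zeros in `Z` are zeros of one polynomial: the terms with index `i > z` vanish at `z`.
  have hle' := card_le_of_eval_descPochhammer_eq_zero (IsLocalRing.residue O) β
    (N := N) (M := N + Z.sup id) (by omega) (by simp [hβN]) (fun i hi => ?_) Z (fun z hz => ?_)
  · omega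
  · rw [IsLocalRing.residue_eq_zero_iff, IsLocalRing.mem_maximalIdeal, mem_nonunits_iff]
    rintro hu
    obtain ⟨v, hv⟩ := hu.exists_right_inv
    have h1 : ‖(b i / b N) * (v : k)‖ = 1 := by
      have := congrArg (Subtype.val : O → k) hv
      rw [show (b i / b N) * (v : k) = 1 from this, norm_one]
    have h2 : ‖b i / b N‖ < 1 := by
      rw [norm_div]
      exact (div_lt_one (norm_pos_iff.2 hN0)).2 (hlt i hi)
    have h3 : ‖(v : k)‖ ≤ 1 := (hO _).1 v.2
    rw [norm_mul] at h1
    nlinarith [norm_nonneg (b i / b N), norm_nonneg (v : k)]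
  · have hz0 : ∑ i ∈ Finset.range (z + 1), (z.choose i : k) * c i = 0 := hZ hz
    have hzM : z + 1 ≤ N + Z.sup id + 1 := by
      have : z ≤ Z.sup id := Finset.le_sup (f := id) hz
      omega
    apply Subtype.ext
    have hterm : ∀ i, (z.choose i : k) * c i / b N = b i / b N * (z.descFactorial i : k) :=
      fun i => by
        rw [Nat.descFactorial_eq_factorial_mul_choose, Nat.cast_mul, hbdef]
        field_simp [hfac i]
    have hsum : ∑ i ∈ Finset.range (N + Z.sup id + 1), b i / b N * (z.descFactorial i : k) = 0 := by
      rw [← Finset.sum_subset (Finset.range_subset_range.2 hzM)]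
      · simp_rw [← hterm, ← Finset.sum_div, hz0, zero_div]
      · intro i _ hi
        rw [Nat.descFactorial_of_lt (by simpa using hi), Nat.cast_zero, mul_zero]
    push_cast
    exact hsum

/-! ### Iterates close to the identity -/

section GaussNorm

variable {k : Type*} [NormedField k] [IsUltrametricDist k]

theorem gaussNorm_pow {ε : ℝ} (hε : 0 < ε) (P : k[X]) (n : ℕ) :
    (P ^ n).gaussNorm (NormedField.toAbsoluteValue k) ε =
      P.gaussNorm (NormedField.toAbsoluteValue k) ε ^ n := by
  have := gaussNorm_isAbsoluteValue (v := NormedField.toAbsoluteValue k)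
    (fun x y => IsUltrametricDist.norm_add_le_max x y) hε
  exact IsAbsoluteValue.abv_pow _ P n

/-- The absolute values of the factorials in a nonarchimedean field of characteristic zero decrease
at most geometrically, with a ratio `σ` such that the Gauss norm of `(1 + X)ᴸ - 1` on the disc of
radius `ε < 1` is smaller than `σ` for some `L`. In residue characteristic zero `σ = 1` and `L = 1`
do; in residue characteristic `p`, take `σ = ‖p‖` and a large power of `p` for `L`. -/
theorem exists_gaussNorm_one_add_X_pow_sub_one_lt [CharZero k] {ε : ℝ} (hε0 : 0 < ε) (hε1 : ε < 1) :
    ∃ (L : ℕ) (σ : ℝ), 0 < L ∧ 0 < σ ∧ (∀ i : ℕ, σ ^ i ≤ ‖(i.factorial : k)‖) ∧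
      ((1 + X : k[X]) ^ L - 1).gaussNorm (NormedField.toAbsoluteValue k) ε < σ := by
  set v := NormedField.toAbsoluteValue k with hv
  have hna : IsNonarchimedean v := fun x y => IsUltrametricDist.norm_add_le_max x y
  have hX : (X : k[X]).gaussNorm v ε = ε := by
    rw [← monomial_one_one_eq_X, gaussNorm_monomial]
    simp
  by_cases hp : ∃ m : ℕ, m ≠ 0 ∧ ‖(m : k)‖ < 1
  swap
  · push Not at hp
    refine ⟨1, 1, one_pos, one_pos, fun i => ?_, by simpa [hX] using hε1⟩
    simpa using hp _ i.factorial_ne_zero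
  -- The least positive integer of norm less than one is the residue characteristic.
  classical
  set p := Nat.find hp with hpdef
  obtain ⟨hp0, hp1⟩ : p ≠ 0 ∧ ‖(p : k)‖ < 1 := Nat.find_spec hp
  have hmin : ∀ m : ℕ, m ≠ 0 → m < p → ‖(m : k)‖ = 1 := fun m hm0 hm => by
    have := Nat.find_min hp hm
    push Not at this
    exact le_antisymm (IsUltrametricDist.norm_natCast_le_one k m) (this hm0)
  have hprime : p.Prime := by
    rw [Nat.prime_def_lt]
    have hpne : p ≠ 1 := fun h => by simp [h] at hp1
    refine ⟨by omega, fun m hm hdvd => ?_⟩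
    obtain ⟨d, hd⟩ := hdvd
    by_contra hm1
    have hm0 : m ≠ 0 := by rintro rfl; simp at hd; omega
    have hd0 : d ≠ 0 := by rintro rfl; simp at hd; omega
    have hdp : d < p := by
      rw [hd]
      exact lt_mul_of_one_lt_left (by omega) (by omega)
    rw [hd, Nat.cast_mul, norm_mul, hmin m hm0 hm, hmin d hd0 hdp] at hp1
    norm_num at hp1
  have : Fact p.Prime := ⟨hprime⟩
  have hpos : 0 < ‖(p : k)‖ := norm_pos_iff.2 (Nat.cast_ne_zero.2 hp0)
  have hcop : ∀ m : ℕ, ¬ p ∣ m → ‖(m : k)‖ = 1 := fun m hm => by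
    have h1 : ‖((m % p : ℕ) : k)‖ = 1 :=
      hmin _ (fun h => hm (Nat.dvd_of_mod_eq_zero h)) (Nat.mod_lt _ hprime.pos)
    refine le_antisymm (IsUltrametricDist.norm_natCast_le_one k m) (not_lt.1 fun hlt => ?_)
    have h2 : ((m % p : ℕ) : k) = (m : k) - (p : k) * ((m / p : ℕ) : k) := by
      rw [eq_sub_iff_add_eq, ← Nat.cast_mul, ← Nat.cast_add, Nat.mod_add_div]
    have h3 : ‖(p : k) * ((m / p : ℕ) : k)‖ < 1 := by
      rw [norm_mul]
      exact mul_lt_one_of_nonneg_of_lt_one_left (norm_nonneg _) hp1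
        (IsUltrametricDist.norm_natCast_le_one k _)
    have h4 := IsUltrametricDist.norm_add_le_max (m : k) (-((p : k) * ((m / p : ℕ) : k)))
    rw [← sub_eq_add_neg, ← h2, h1, norm_neg] at h4
    exact absurd h4 (not_le.2 (max_lt hlt h3))
  have hfac : ∀ i : ℕ, ‖(p : k)‖ ^ i ≤ ‖(i.factorial : k)‖ := fun i => by
    obtain ⟨e, m, hm, he⟩ := Nat.exists_eq_pow_mul_and_not_dvd i.factorial_ne_zero p hprime.ne_one
    have hei : e ≤ i :=
      ((padicValNat_dvd_iff_le (p := p) i.factorial_ne_zero).1 ⟨m, he⟩).trans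
        (padicValNat_factorial_le p i)
    rw [he, Nat.cast_mul, norm_mul, hcop m hm, mul_one, Nat.cast_pow, norm_pow]
    exact pow_le_pow_of_le_one hpos.le hp1.le hei
  -- `Q ↦ (1 + Q)ᵖ - 1` contracts the Gauss norm by the factor `θ`.
  set θ := max ε ‖(p : k)‖ with hθ
  have hθ0 : 0 < θ := lt_max_of_lt_left hε0
  have hθ1 : θ < 1 := max_lt hε1 hp1
  have hstep : ∀ Q : k[X], Q.gaussNorm v ε ≤ ε →
      ((1 + Q) ^ p - 1).gaussNorm v ε ≤ θ * Q.gaussNorm v ε := by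
    intro Q hQ
    have hQ0 : 0 ≤ Q.gaussNorm v ε := gaussNorm_nonneg v Q hε0.le
    have hexp : (1 + Q) ^ p - 1 =
        ∑ i ∈ Finset.range p, Q ^ (i + 1) * C ((p.choose (i + 1) : ℕ) : k) := by
      rw [add_comm, add_pow, Finset.sum_range_succ']
      simp
    rw [hexp]
    obtain ⟨i, hi, hle⟩ := IsNonarchimedean.finset_image_add_of_nonempty
      (isNonarchimedean_gaussNorm v hna hε0.le)
      (fun i => Q ^ (i + 1) * C ((p.choose (i + 1) : ℕ) : k))
      (Finset.nonempty_range_iff.2 hp0)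
    refine hle.trans ?_
    have hip : i + 1 ≤ p := Finset.mem_range.1 hi
    have hv1 : ‖((p.choose (i + 1) : ℕ) : k)‖ ≤ 1 := IsUltrametricDist.norm_natCast_le_one k _
    rw [gaussNorm_mul hna hε0, gaussNorm_pow hε0, gaussNorm_C]
    change _ * ‖((p.choose (i + 1) : ℕ) : k)‖ ≤ _
    rcases hip.eq_or_lt with heq | hlt
    · have hi1 : i ≠ 0 := by
        rintro rfl
        exact hprime.ne_one heq.symm
      have hQi : Q.gaussNorm v ε ^ i ≤ θ :=
        (pow_le_of_le_one hQ0 (hQ.trans hε1.le) hi1).trans (hQ.trans (le_max_left _ _))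
      calc _ ≤ Q.gaussNorm v ε ^ (i + 1) := mul_le_of_le_one_right (pow_nonneg hQ0 _) hv1
        _ = Q.gaussNorm v ε ^ i * Q.gaussNorm v ε := pow_succ _ _
        _ ≤ θ * Q.gaussNorm v ε := by gcongr
    · have hvp : ‖((p.choose (i + 1) : ℕ) : k)‖ ≤ θ := by
        obtain ⟨d, hd⟩ := hprime.dvd_choose_self (Nat.succ_ne_zero i) hlt
        rw [hd, Nat.cast_mul, norm_mul]
        exact (mul_le_of_le_one_right hpos.le
          (IsUltrametricDist.norm_natCast_le_one k d)).trans (le_max_right _ _)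
      rw [mul_comm θ]
      gcongr
      exact pow_le_of_le_one hQ0 (hQ.trans hε1.le) (Nat.succ_ne_zero i)
  have hiter : ∀ m : ℕ, ((1 + X : k[X]) ^ p ^ m - 1).gaussNorm v ε ≤ θ ^ m * ε := by
    intro m
    induction m with
    | zero => simp [hX]
    | succ m ih =>
      have h1 := hstep _ (ih.trans (mul_le_of_le_one_left hε0.le (pow_le_one₀ hθ0.le hθ1.le)))
      rw [add_sub_cancel, ← pow_mul, ← pow_succ] at h1
      calc _ ≤ _ := h1
        _ ≤ θ * (θ ^ m * ε) := by gcongr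
        _ = _ := by ring
  obtain ⟨m, hm⟩ := exists_pow_lt_of_lt_one hpos hθ1
  refine ⟨p ^ m, ‖(p : k)‖, pow_pos hprime.pos m, hpos, hfac, (hiter m).trans_lt ?_⟩
  exact (mul_le_of_le_one_right (pow_pos hθ0 m).le hε1.le).trans_lt hm

/-- A polynomial `P` in `D`, tested against a functional `φ`, has size at most the Gauss norm of `P`
on a disc whose radius governs the decay of the powers of `D`. -/
theorem norm_apply_aeval_le {M : Type*} [AddCommGroup M] [Module k M] (D : Module.End k M)
    (φ : M →ₗ[k] k) (m : M) {K ε : ℝ} (hε : 0 ≤ ε) (h : ∀ l : ℕ, ‖φ ((D ^ l) m)‖ ≤ K * ε ^ l)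
    (P : k[X]) :
    ‖φ (aeval D P m)‖ ≤ K * P.gaussNorm (NormedField.toAbsoluteValue k) ε := by
  have hK : 0 ≤ K := by simpa using (norm_nonneg _).trans (h 0)
  rw [aeval_eq_sum_range, LinearMap.sum_apply, map_sum]
  refine IsUltrametricDist.norm_sum_le_of_forall_le_of_nonneg
    (mul_nonneg hK (gaussNorm_nonneg _ P hε)) fun l _ => ?_
  rw [LinearMap.smul_apply, map_smul, smul_eq_mul, norm_mul]
  calc ‖P.coeff l‖ * ‖φ ((D ^ l) m)‖ ≤ ‖P.coeff l‖ * (K * ε ^ l) := by gcongr; exact h l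
    _ = K * (‖P.coeff l‖ * ε ^ l) := by ring
    _ ≤ _ := by
      gcongr
      exact le_gaussNorm (NormedField.toAbsoluteValue k) P hε l

end GaussNorm

/-- If the powers of `D` decay at least like `εˡ` on the orbit of `m`, then for a suitable `L`,
depending only on `ε`, the function `n ↦ φ ((1 + D)ᴸⁿ m)` is zero or has finitely many zeros. Its
Newton coefficients are the `φ (Qⁱ m)` with `Q = (1 + D)ᴸ - 1`. -/
theorem exists_finite_or_eq_univ_zeros_orbit {k : Type*} [NormedField k] [IsUltrametricDist k]
    [CharZero k] {ε : ℝ} (hε0 : 0 < ε) (hε1 : ε < 1) :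
    ∃ L : ℕ, 0 < L ∧ ∀ (M : Type*) [AddCommGroup M] [Module k M] (D : Module.End k M)
      (φ : M →ₗ[k] k) (m : M) (K : ℝ), (∀ l : ℕ, ‖φ ((D ^ l) m)‖ ≤ K * ε ^ l) →
        {n : ℕ | φ (((1 + D) ^ (L * n)) m) = 0}.Finite ∨
          {n : ℕ | φ (((1 + D) ^ (L * n)) m) = 0} = Set.univ := by
  obtain ⟨L, σ, hL, hσ, hfac, hlt⟩ :=
    exists_gaussNorm_one_add_X_pow_sub_one_lt (k := k) hε0 hε1
  refine ⟨L, hL, fun M _ _ D φ m K hK => ?_⟩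
  set Q : k[X] := (1 + X) ^ L - 1 with hQ
  set η := Q.gaussNorm (NormedField.toAbsoluteValue k) ε with hη
  have hη0 : 0 ≤ η := gaussNorm_nonneg _ Q hε0.le
  have hK0 : 0 ≤ K := by simpa using (norm_nonneg _).trans (hK 0)
  have haeval : (1 + D) ^ L = aeval D Q + 1 := by simp [hQ]
  have hnewton : ∀ n : ℕ, φ (((1 + D) ^ (L * n)) m) =
      ∑ i ∈ Finset.range (n + 1), (n.choose i : k) * φ ((aeval D Q ^ i) m) := fun n => by
    rw [pow_mul, haeval, (Commute.one_right (aeval D Q)).add_pow, LinearMap.sum_apply, map_sum]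
    refine Finset.sum_congr rfl fun i _ => ?_
    rw [one_pow, mul_one, ← nsmul_eq_mul', LinearMap.smul_apply, map_nsmul, nsmul_eq_mul]
  simp_rw [hnewton]
  refine finite_or_eq_univ_zeros_newton ?_
  have hgeom : Tendsto (fun i : ℕ => K * (η / σ) ^ i) atTop (𝓝 0) := by
    simpa using (tendsto_pow_atTop_nhds_zero_of_lt_one (by positivity)
      ((div_lt_one hσ).2 hlt)).const_mul K
  refine squeeze_zero_norm (fun i => ?_) hgeom
  rw [norm_div, div_pow, mul_div_assoc', ← map_pow]
  have h1 := norm_apply_aeval_le D φ m hε0.le hK (Q ^ i)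
  rw [gaussNorm_pow hε0] at h1
  exact div_le_div₀ (by positivity) h1 (by positivity) (hfac i)

/-! ### Decay of the powers of an operator of small spectral radius -/

/-- If a bounded operator has spectral radius less than one, then its powers decay geometrically. -/
theorem exists_norm_pow_le_of_spectralRadius_lt_one {k A : Type*} [NormedField k]
    [NormedCommRing A] [NormedAlgebra k A] (T : A →ₗ[k] A)
    (hT : ∃ C : ℝ, ∀ a : A, ‖T a‖ ≤ C * ‖a‖) (h : spectralRadius T < 1) :
    ∃ K ε : ℝ, 0 < ε ∧ ε < 1 ∧ ∀ (l : ℕ) (a : A), ‖(T ^ l) a‖ ≤ K * ε ^ l * ‖a‖ := by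
  obtain ⟨C₀, hC₀⟩ := hT
  set B := max C₀ 1 with hB
  have hB1 : 1 ≤ B := le_max_right _ _
  have hpow : ∀ (l : ℕ) (a : A), ‖(T ^ l) a‖ ≤ B ^ l * ‖a‖ := fun l a => by
    induction l with
    | zero => simp
    | succ l ih =>
      rw [pow_succ', Module.End.mul_apply]
      calc ‖T ((T ^ l) a)‖ ≤ C₀ * ‖(T ^ l) a‖ := hC₀ _
        _ ≤ B * (B ^ l * ‖a‖) := by gcongr; exact le_max_left _ _
        _ = _ := by ring
  obtain ⟨n, hn⟩ := exists_lt_of_ciInf_lt h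
  have hop : opNorm (T ^ (n + 1)) < 1 := by
    by_contra hge
    exact absurd hn (not_lt.2 (Real.one_le_rpow (not_lt.1 hge) (by positivity)))
  have hne : {C : ℝ | 0 ≤ C ∧ ∀ a : A, ‖(T ^ (n + 1)) a‖ ≤ C * ‖a‖}.Nonempty :=
    ⟨B ^ (n + 1), by positivity, hpow (n + 1)⟩
  obtain ⟨c, ⟨-, hc⟩, hc1⟩ := exists_lt_of_csInf_lt hne hop
  -- A positive bound is needed to take roots, and to divide by powers of `ε`.
  set d := max c (1 / 2) with hd
  have hd0 : 0 < d := lt_max_of_lt_right (by norm_num)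
  have hd1 : d < 1 := max_lt hc1 (by norm_num)
  have hblock : ∀ (q : ℕ) (a : A), ‖((T ^ (n + 1)) ^ q) a‖ ≤ d ^ q * ‖a‖ := fun q a => by
    induction q with
    | zero => simp
    | succ q ih =>
      rw [pow_succ' (T ^ (n + 1)), Module.End.mul_apply]
      calc _ ≤ c * ‖((T ^ (n + 1)) ^ q) a‖ := hc _
        _ ≤ d * (d ^ q * ‖a‖) := by gcongr; exact le_max_left _ _
        _ = _ := by ring
  set ε := d ^ (1 / ((n : ℝ) + 1)) with hε
  have hε0 : 0 < ε := Real.rpow_pos_of_pos hd0 _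
  have hε1 : ε < 1 := Real.rpow_lt_one hd0.le hd1 (by positivity)
  have hεn : ε ^ (n + 1) = d := by
    rw [hε, ← Real.rpow_natCast, ← Real.rpow_mul hd0.le]
    push_cast
    rw [one_div_mul_cancel (by positivity), Real.rpow_one]
  refine ⟨B ^ (n + 1) / ε ^ (n + 1), ε, hε0, hε1, fun l a => ?_⟩
  have hl : l % (n + 1) ≤ n + 1 := (Nat.mod_lt _ n.succ_pos).le
  calc ‖(T ^ l) a‖ = ‖((T ^ (n + 1)) ^ (l / (n + 1))) ((T ^ (l % (n + 1))) a)‖ := by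
        rw [← Module.End.mul_apply, ← pow_mul, ← pow_add, Nat.div_add_mod]
    _ ≤ d ^ (l / (n + 1)) * (B ^ (l % (n + 1)) * ‖a‖) := (hblock _ _).trans (by
        gcongr
        exact hpow _ _)
    _ ≤ d ^ (l / (n + 1)) * (B ^ (n + 1) * ‖a‖) := by gcongr
    _ = B ^ (n + 1) * d ^ (l / (n + 1)) * ‖a‖ := by ring
    _ ≤ B ^ (n + 1) * (ε ^ l / ε ^ (n + 1)) * ‖a‖ := by
        gcongr
        rw [le_div_iff₀ (by positivity), ← hεn, ← pow_mul, ← pow_add]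
        refine pow_le_pow_of_le_one hε0.le hε1.le ?_
        have := Nat.div_add_mod l (n + 1)
        omega
    _ = _ := by ring

/-! ### Orbits -/

theorem Automorphism.seminorm_iterate_toFun {k A : Type*} [NormedField k] [NormedCommRing A]
    [NormedAlgebra k A] (f : Automorphism k A) (x : Spectrum A) (n : ℕ) (a : A) :
    (f.toFun^[n] x).seminorm a = x.seminorm (f.pullback^[n] a) := by
  induction n generalizing a with
  | zero => rfl
  | succ n ih =>
    rw [Function.iterate_succ_apply', Function.iterate_succ_apply, ← ih]
    rfl

theorem Automorphism.one_add_difference_pow_apply {k A : Type*} [NormedField k] [NormedCommRing A]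
    [NormedAlgebra k A] (f : Automorphism k A) (n : ℕ) (a : A) :
    (((1 : Module.End k A) + f.difference) ^ n) a = f.pullback^[n] a := by
  have h : (1 : Module.End k A) + f.difference = f.pullback.toLinearMap :=
    add_sub_cancel _ _
  rw [h, Module.End.pow_apply]
  rfl

end Affinoid

/-- A set of natural numbers whose trace on each residue class modulo `L` is finite or full is a
finite union of arithmetic progressions. -/
theorem exists_eq_biUnion_arithmeticProgression {E : Set ℕ} {L : ℕ} (hL : 0 < L)
    (h : ∀ r < L, {n | L * n + r ∈ E}.Finite ∨ {n | L * n + r ∈ E} = Set.univ) :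
    ∃ S : Finset (ℕ × ℕ), E = ⋃ p ∈ S, arithmeticProgression p.1 p.2 := by
  have hclass : ∀ r, ∃ S : Finset (ℕ × ℕ), r < L →
      ∀ m, (m ∈ E ∧ m % L = r) ↔ ∃ p ∈ S, m ∈ arithmeticProgression p.1 p.2 := by
    intro r
    by_cases hr : r < L
    swap
    · exact ⟨∅, fun h => absurd h hr⟩
    rcases h r hr with hfin | huniv
    · refine ⟨hfin.toFinset.image fun n => (0, L * n + r), fun _ m => ⟨?_, ?_⟩⟩
      · rintro ⟨hm, rfl⟩
        refine ⟨(0, m), ?_, 0, by simp⟩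
        rw [Finset.mem_image]
        exact ⟨m / L, by simpa [Nat.div_add_mod] using hm, by simp [Nat.div_add_mod]⟩
      · rintro ⟨p, hp, n, rfl⟩
        obtain ⟨i, hi, rfl⟩ := Finset.mem_image.1 hp
        simpa [Nat.mod_eq_of_lt hr] using hi
    · refine ⟨{(L, r)}, fun _ m => ⟨?_, ?_⟩⟩
      · rintro ⟨-, rfl⟩
        exact ⟨(L, m % L), by simp, m / L, (Nat.div_add_mod _ _).symm⟩
      · rintro ⟨p, hp, n, rfl⟩
        obtain rfl := Finset.mem_singleton.1 hp
        exact ⟨(Set.ext_iff.1 huniv n).2 trivial, by simp [Nat.mod_eq_of_lt hr]⟩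
  choose S hS using hclass
  refine ⟨(Finset.range L).biUnion S, Set.ext fun m => ?_⟩
  simp only [Set.mem_iUnion, Finset.mem_biUnion, Finset.mem_range, exists_prop]
  constructor
  · intro hm
    have hr := Nat.mod_lt m hL
    obtain ⟨p, hp, hmp⟩ := (hS _ hr m).1 ⟨hm, rfl⟩
    exact ⟨p, ⟨_, hr, hp⟩, hmp⟩
  · rintro ⟨p, ⟨r, hr, hp⟩, hmp⟩
    exact ((hS r hr m).2 ⟨p, hp, hmp⟩).1

theorem theorem8 {k A : Type*} [NormedField k] [CompleteSpace k] [IsUltrametricDist k] [CharZero k]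
    [NormedCommRing A] [NormedAlgebra k A] [CompleteSpace A]
    (hA : Affinoid.IsAffinoidAlgebra k A)
    (f : Affinoid.Automorphism k A)
    (hf : Affinoid.spectralRadius f.difference < 1)
    (V : Set (Affinoid.Spectrum A)) (hV : Affinoid.IsZariskiClosed V)
    (x : Affinoid.Spectrum A) (hx : Affinoid.IsRationalPoint k x) :
    ∃ S : Finset (ℕ × ℕ),
      {n : ℕ | f.toFun^[n] x ∈ V} = ⋃ p ∈ S, arithmeticProgression p.1 p.2 := by
  obtain ⟨I, rfl⟩ := hV
  obtain ⟨χ, hχ⟩ := hx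
  obtain ⟨C, hC⟩ := x.bounded
  obtain ⟨B, hB⟩ := f.bounded
  obtain ⟨K, ε, hε0, hε1, hdecay⟩ := Affinoid.exists_norm_pow_le_of_spectralRadius_lt_one
    f.difference ⟨B + 1, fun a => by
      calc ‖f.pullback a - a‖ ≤ ‖f.pullback a‖ + ‖a‖ := norm_sub_le _ _
        _ ≤ B * ‖a‖ + ‖a‖ := by gcongr; exact hB a
        _ = (B + 1) * ‖a‖ := by ring⟩ hf
  obtain ⟨L, hL, hzeros⟩ :=
    Affinoid.exists_finite_or_eq_univ_zeros_orbit (k := k) hε0 hε1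
  refine exists_eq_biUnion_arithmeticProgression hL fun r _ => ?_
  have hmem : ∀ n, f.toFun^[L * n + r] x ∈ {y : Affinoid.Spectrum A | ∀ g ∈ I, y.seminorm g = 0} ↔
      ∀ g ∈ I, χ.toLinearMap (((1 + f.difference) ^ (L * n)) (f.pullback^[r] g)) = 0 := fun n => by
    simp only [Set.mem_ofPred_eq, f.seminorm_iterate_toFun, hχ, norm_eq_zero,
      f.one_add_difference_pow_apply, ← Function.iterate_add_apply, AlgHom.toLinearMap_apply]
  by_cases hall : ∀ g ∈ I, {n : ℕ |
      χ.toLinearMap (((1 + f.difference) ^ (L * n)) (f.pullback^[r] g)) = 0} = Set.univ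
  · exact Or.inr (Set.eq_univ_of_forall fun n =>
      (hmem n).2 fun g hg => (Set.ext_iff.1 (hall g hg) n).2 trivial)
  · push Not at hall
    obtain ⟨g, hg, hne⟩ := hall
    refine Or.inl (((hzeros A f.difference χ.toLinearMap (f.pullback^[r] g)
      (max C 0 * K * ‖f.pullback^[r] g‖) fun l => ?_).resolve_right hne).subset
        fun n hn => (hmem n).1 hn g hg)
    rw [AlgHom.toLinearMap_apply, ← hχ]
    calc _ ≤ C * ‖(f.difference ^ l) (f.pullback^[r] g)‖ := hC _
      _ ≤ max C 0 * ‖(f.difference ^ l) (f.pullback^[r] g)‖ := by gcongr; exact le_max_left _ _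
      _ ≤ max C 0 * (K * ε ^ l * ‖f.pullback^[r] g‖) := by gcongr; exact hdecay _ _
      _ = _ := by ring
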